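/- For a (possibly empty) polytope $P\subseteq\mathbb R^n$ let $f_P(t)=\sum_{i=0}^{\dim P} f_i\,t^i$, where $f_i$ is the number of $i$-dimensional nonempty faces of $P$, including $P$ itself (so $f_\varnothing=0$). Let $\Delta_{k,n}\subseteq\mathbb R^n$ be the hypersimplex, i.e. the convex hull of the $0/1$-vectors with exactly $k$ ones, and let $$\mathscr P(\Lambda_{k-r,k,n-h,n})=\Big\{x\in\Delta_{k,n} : \sum_{i=1}^h x_i\le r\Big\},\qquad u_{r,k,h,n}(t)=f_{\Delta_{k,n}}(t)-f_{\mathscr P(\Lambda_{k-r,k,n-h,n})}(t).$$ Write $\binom{N}{i,j}=\frac{N!}{i!\,j!\,(N-i-j)!}$ for $i+j\le N$, and let $p'_{r,h}(t)=f_{\Delta_{r,h}}(t)-\binom hr$ and $$p_{r,k,h,n}(t)=\sum_{j=0}^{h-r-1}\ \sum_{i=0}^{\min\{h-j,\,k-1\}}\ \sum_{\ell=0}^{\min\{k-i-1,\,k-r-1\}}\ \sum_{m=0}^{\min\{n-h-\ell,\,n-k-j-1\}}\binom{h}{i,j}\binom{n-h}{\ell,m}\,t^{\,n-1-i-j-\ell-m},$$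 where a sum whose upper limit is negative is empty. **Proposition 2.6.** For all integers $0<r<k<n$ and $r<h<n$, $$u_{r,k,h,n}(t)=p_{r,k,h,n}(t)-p'_{r,h}(t)\cdot p'_{k-r,n-h}(t)\cdot(1+t)+\sum_{i=r+1}^{k}\binom hi\binom{n-h}{k-i}.$$ -/

import Mathlib

open Polynomial

/-- The set of `i`-dimensional faces of a polytope `P ⊆ ℝⁿ`. A face is a nonempty subset of the form
`{x ∈ P | ℓ x = max_P ℓ}` for a linear functional `ℓ`; taking `ℓ = 0` shows that a nonempty `P` is
a face of itself. The dimension of a face is the dimension of its affine span. -/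
def polytopeFaces {n : ℕ} (P : Set (Fin n → ℝ)) (i : ℕ) : Set (Set (Fin n → ℝ)) :=
  {F | F.Nonempty ∧ IsExposed ℝ P F ∧ Module.finrank ℝ (vectorSpan ℝ F) = i}

/-- The `f`-polynomial `∑_{i=0}^{d} f_i t^i` of a polytope `P` of dimension `d`, where `f_i` is the
number of `i`-dimensional faces of `P`. It is `0` if `P` is empty. -/
noncomputable def fPoly {n : ℕ} (P : Set (Fin n → ℝ)) : ℤ[X] :=
  ∑ i ∈ Finset.range (Module.finrank ℝ (vectorSpan ℝ P) + 1),
    C ((polytopeFaces P i).ncard : ℤ) * X ^ i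

/-- The hypersimplex `Δ_{k,n} ⊆ ℝⁿ`: the base polytope of the uniform matroid `U_{k,n}`, that is,
the convex hull of the indicator vectors of the `k`-element subsets of the ground set. -/
def hypersimplex (k n : ℕ) : Set (Fin n → ℝ) :=
  convexHull ℝ {v | ∃ B : Finset (Fin n), B.card = k ∧ v = fun i => if i ∈ B then 1 else 0}

/-- The base polytope of the Schubert elementary split matroid `Λ_{k-r,k,n-h,n}`: the part of the
hypersimplex `Δ_{k,n}` where the sum of the first `h` coordinates is at most `r`. (For
`k - r > n - h` this set is empty.) -/
def schubertPolytope (r k h n : ℕ) : Set (Fin n → ℝ) :=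
  {x | x ∈ hypersimplex k n ∧ ∑ i : Fin n with i.val < h, x i ≤ (r : ℝ)}

/-- `u_{r,k,h,n}(t)`, the difference of the `f`-polynomials of the two polytopes above. -/
noncomputable def uPoly (r k h n : ℕ) : ℤ[X] :=
  fPoly (hypersimplex k n) - fPoly (schubertPolytope r k h n)

/-- `p'_{r,h}(t) = f_{Δ_{r,h}}(t) - binom(h, r)`. -/
noncomputable def pPrime (r h : ℕ) : ℤ[X] :=
  fPoly (hypersimplex r h) - C (h.choose r : ℤ)

/-- The multinomial coefficient `N! / (i! j! (N - i - j)!)`, used for `i + j ≤ N` only. -/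
def triCoeff (N i j : ℕ) : ℕ :=
  N.factorial / (i.factorial * j.factorial * (N - i - j).factorial)

/-- `p_{r,k,h,n}(t)`, the sum of `binom(h; i, j) binom(n-h; ℓ, m) t^(n-1-i-j-ℓ-m)` over
`0 ≤ j ≤ h-r-1`, `0 ≤ i ≤ min(h-j, k-1)`, `0 ≤ ℓ ≤ min(k-i-1, k-r-1)` and
`0 ≤ m ≤ min(n-h-ℓ, n-k-j-1)`. A sum over an index from `0` to an integer `b`, empty if `b < 0`,
is written as a sum over `Finset.range (b + 1)`; the truncation at `0` of the
natural-number subtractions in the upper bounds agrees with this convention. -/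
noncomputable def pPoly (r k h n : ℕ) : ℤ[X] :=
  ∑ j ∈ Finset.range (h - r),
    ∑ i ∈ Finset.range (min (h + 1 - j) k),
      ∑ l ∈ Finset.range (min (k - i) (k - r)),
        ∑ m ∈ Finset.range (min (n - h + 1 - l) (n - k - j)),
          C ((triCoeff h i j * triCoeff (n - h) l m : ℕ) : ℤ) * X ^ (n - 1 - i - j - l - m)

/-! A nonempty face of a polyhedron given by finitely many inequalities is determined by the set of
inequalities tight on all of it, and its dimension is that of the space of directions keeping them
tight (`fPoly_polyhedron`). For the two polytopes here such a set is a disjoint pair (I, J), the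
coordinates equal to 1 and to 0, together with, for the truncated polytope, one bit: whether the sum
over the set S of the first h coordinates equals r. Which sets occur, and in which dimension,
depends only on the numbers i, l of ones and a, c of free coordinates inside and outside S. So u is
a sum over these numbers with binomial weights (`uPoly_eq`).

The formula then holds type by type (`hypersimplexTerm_sub_slabTerm`). A face of the hypersimplex on
which the S-sum is at most r contributes nothing to u. Those on which it somewhere exceeds r are
counted by p, or by the last sum if they are vertices. This is their exact contribution unless the
S-sum also takes values below r. A face of dimension d that is cut in this way leaves a piece of
dimension d and a section of dimension d - 1, so t^(d-1) (1 + t) must be subtracted. The section is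
a product of positive-dimensional faces of Δ_{r,h} and Δ_{k-r,n-h}, which gives the product p' · p'
· (1 + t). -/

/-! ### Faces of a polyhedron and their tight inequalities -/

/-- The polyhedron cut out by the inequalities `a i x ≤ b i`. -/
def polyhedron {n : ℕ} {ι : Type*} (a : ι → (Fin n → ℝ) →ₗ[ℝ] ℝ) (b : ι → ℝ) :
    Set (Fin n → ℝ) :=
  {x | ∀ i, a i x ≤ b i}

/-- The part of a polyhedron where all inequalities that are tight at `x` are tight. -/
def tightFace {n : ℕ} {ι : Type*} (a : ι → (Fin n → ℝ) →ₗ[ℝ] ℝ) (b : ι → ℝ) (x : Fin n → ℝ) :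
    Set (Fin n → ℝ) :=
  {y | y ∈ polyhedron a b ∧ ∀ i, a i x = b i → a i y = b i}

/-- The directions along which all inequalities that are tight at `x` stay tight. -/
def tightDirection {n : ℕ} {ι : Type*} (a : ι → (Fin n → ℝ) →ₗ[ℝ] ℝ) (b : ι → ℝ)
    (x : Fin n → ℝ) : Submodule ℝ (Fin n → ℝ) where
  carrier := {v | ∀ i, a i x = b i → a i v = 0}
  add_mem' hu hv i hi := by rw [map_add, hu i hi, hv i hi, add_zero]
  zero_mem' i _ := map_zero _
  smul_mem' c v hv i hi := by rw [map_smul, hv i hi, smul_zero]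

theorem self_mem_tightFace {n : ℕ} {ι : Type*} {a : ι → (Fin n → ℝ) →ₗ[ℝ] ℝ} {b : ι → ℝ}
    {x : Fin n → ℝ} (hx : x ∈ polyhedron a b) :
    x ∈ tightFace a b x :=
  ⟨hx, fun _ h => h⟩

theorem tightFace_eq_iff {n : ℕ} {ι : Type*} {a : ι → (Fin n → ℝ) →ₗ[ℝ] ℝ} {b : ι → ℝ}
    {x y : Fin n → ℝ} (hx : x ∈ polyhedron a b) (hy : y ∈ polyhedron a b) :
    tightFace a b x = tightFace a b y ↔ ∀ i, a i x = b i ↔ a i y = b i := by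
  constructor
  · intro h i
    have h1 : y ∈ tightFace a b x := h ▸ self_mem_tightFace hy
    have h2 : x ∈ tightFace a b y := h ▸ self_mem_tightFace hx
    exact ⟨h1.2 i, h2.2 i⟩
  · intro h
    ext z
    simp only [tightFace, h]

section Polyhedron

variable {n : ℕ} {ι : Type*} [Finite ι] {a : ι → (Fin n → ℝ) →ₗ[ℝ] ℝ} {b : ι → ℝ}

/-- Finitely many slack inequalities survive a small move by continuity; the tight ones do not
increase along v. -/
theorem exists_pos_add_smul_mem_polyhedron {x v : Fin n → ℝ} (hx : x ∈ polyhedron a b)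
    (hv : ∀ i, a i x = b i → a i v ≤ 0) : ∃ ε : ℝ, 0 < ε ∧ x + ε • v ∈ polyhedron a b := by
  have key : ∀ᶠ ε : ℝ in nhdsWithin 0 (Set.Ioi 0), ∀ i, a i (x + ε • v) ≤ b i := by
    rw [Filter.eventually_all]
    intro i
    rcases (hx i).lt_or_eq with hlt | heq
    · have hc : Filter.Tendsto (fun ε : ℝ => a i x + ε * a i v) (nhds 0)
          (nhds (a i x + 0 * a i v)) := by
        apply Continuous.tendsto (f := fun ε : ℝ => a i x + ε * a i v)
        fun_prop
      rw [zero_mul, add_zero] at hc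
      filter_upwards [nhdsWithin_le_nhds (hc.eventually_lt_const hlt)] with ε hε
      rw [map_add, map_smul, smul_eq_mul]
      exact hε.le
    · filter_upwards [self_mem_nhdsWithin] with ε hε
      rw [map_add, map_smul, smul_eq_mul, heq]
      have := mul_nonpos_of_nonneg_of_nonpos (le_of_lt hε) (hv i heq)
      linarith
  obtain ⟨ε, hε, hpos⟩ := (key.and self_mem_nhdsWithin).exists
  exact ⟨ε, hpos, hε⟩

/-- The sum of the functionals tight at x is maximal exactly where each of them attains its bound.
-/
theorem tightFace_isExposed {x : Fin n → ℝ} (hx : x ∈ polyhedron a b) :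
    IsExposed ℝ (polyhedron a b) (tightFace a b x) := by
  classical
  have := Fintype.ofFinite ι
  intro _
  refine ⟨LinearMap.toContinuousLinearMap (∑ i with a i x = b i, a i), ?_⟩
  have happ : ∀ y, (LinearMap.toContinuousLinearMap (∑ i with a i x = b i, a i)) y
      = ∑ i with a i x = b i, a i y := fun y => by simp
  have hsum : ∑ i with a i x = b i, a i x = ∑ i with a i x = b i, b i :=
    Finset.sum_congr rfl fun i hi => (Finset.mem_filter.1 hi).2
  ext y
  simp only [tightFace, Set.mem_ofPred_eq, happ]
  refine and_congr_right fun hy => ⟨fun h z hz => ?_, fun h => ?_⟩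
  · refine Finset.sum_le_sum fun i hi => ?_
    rw [h i (Finset.mem_filter.1 hi).2]
    exact hz i
  · have hle := h x hx
    rw [hsum] at hle
    have heq : ∑ i with a i x = b i, a i y = ∑ i with a i x = b i, b i :=
      le_antisymm (Finset.sum_le_sum fun i _ => hy i) hle
    intro i hi
    exact (Finset.sum_eq_sum_iff_of_le fun i _ => hy i).1 heq i (by simpa using hi)

/-- A point of F with the fewest tight inequalities plays the role of a relative interior point. -/
theorem exists_eq_tightFace {F : Set (Fin n → ℝ)} (hne : F.Nonempty)
    (hF : IsExposed ℝ (polyhedron a b) F) : ∃ x ∈ polyhedron a b, F = tightFace a b x := by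
  classical
  have := Fintype.ofFinite ι
  obtain ⟨l, hl⟩ := hF hne
  obtain ⟨x, hxF, hmin⟩ := (measure fun x => (Finset.univ.filter fun i => a i x = b i).card).wf.has_min
    F hne
  have hxF' := hxF
  rw [hl] at hxF'
  obtain ⟨hxP, hxl⟩ := hxF'
  refine ⟨x, hxP, Set.Subset.antisymm (fun y hy => ?_) fun y hy => ?_⟩
  · have hyF := hy
    rw [hl] at hy
    obtain ⟨hyP, hyl⟩ := hy
    refine ⟨hyP, fun i hi => ?_⟩
    by_contra hne
    -- The midpoint is tight only where both x and y are, so it would contradict minimality.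
    set z : Fin n → ℝ := (1 / 2 : ℝ) • x + (1 / 2 : ℝ) • y with hz
    have haz : ∀ i, a i z = (a i x + a i y) / 2 := fun i => by
      rw [hz, map_add, map_smul, map_smul]; simp only [smul_eq_mul]; ring
    have hlz : l z = (l x + l y) / 2 := by
      rw [hz, map_add, map_smul, map_smul]; simp only [smul_eq_mul]; ring
    have hzP : z ∈ polyhedron a b := fun i => by
      rw [haz]; linarith [hxP i, hyP i]
    have hzF : z ∈ F := by
      rw [hl]
      refine ⟨hzP, fun w hw => ?_⟩
      rw [hlz]; linarith [hxl w hw, hyl w hw]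
    refine hmin z hzF (Finset.card_lt_card ⟨fun j hj => ?_, fun hsub => ?_⟩)
    · simp only [Finset.mem_filter, Finset.mem_univ, true_and] at hj ⊢
      rw [haz] at hj
      linarith [hxP j, hyP j]
    · have := hsub (Finset.mem_filter.2 ⟨Finset.mem_univ i, hi⟩)
      simp only [Finset.mem_filter, Finset.mem_univ, true_and] at this
      rw [haz] at this
      exact hne (by linarith)
  -- One can move from x slightly away from y inside the polyhedron; as l is maximal at x, it cannot
  -- be smaller at y.
  · obtain ⟨ε, hε, hmem⟩ := exists_pos_add_smul_mem_polyhedron (v := x - y) hxP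
      (fun i hi => by rw [map_sub, hi, hy.2 i hi, sub_self])
    have h1 := hxl _ hmem
    rw [map_add, map_smul, map_sub, smul_eq_mul] at h1
    have h2 : l x ≤ l y := by
      by_contra hlt
      have := mul_pos hε (sub_pos.2 (not_le.1 hlt))
      linarith
    rw [hl]
    exact ⟨hy.1, fun w hw => (hxl w hw).trans h2⟩

theorem vectorSpan_tightFace {x : Fin n → ℝ} (hx : x ∈ polyhedron a b) :
    vectorSpan ℝ (tightFace a b x) = tightDirection a b x := by
  apply le_antisymm
  · refine Submodule.span_le.2 ?_
    rintro _ ⟨y, hy, z, hz, rfl⟩ i hi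
    change a i (y - z) = 0
    rw [map_sub, hy.2 i hi, hz.2 i hi, sub_self]
  · intro v hv
    obtain ⟨ε, hε, hmem⟩ := exists_pos_add_smul_mem_polyhedron hx (fun i hi => (hv i hi).le)
    have hface : x + ε • v ∈ tightFace a b x :=
      ⟨hmem, fun i hi => by rw [map_add, map_smul, hv i hi, smul_zero, add_zero, hi]⟩
    have h := vsub_mem_vectorSpan ℝ hface (self_mem_tightFace hx)
    rw [vsub_eq_sub, add_sub_cancel_left] at h
    exact (Submodule.smul_mem_iff _ hε.ne').1 h

/-- The `f`-polynomial of a polyhedron as a sum over the possible sets of tight inequalities,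
these sets being encoded by a map `τ`. -/
theorem fPoly_polyhedron {T : Type*} (τ : (Fin n → ℝ) → T) (U : Finset T) (d : T → ℕ)
    (hτ : ∀ x ∈ polyhedron a b, ∀ y ∈ polyhedron a b,
      τ x = τ y ↔ ∀ i, a i x = b i ↔ a i y = b i)
    (hU : ∀ t, t ∈ U ↔ ∃ x ∈ polyhedron a b, τ x = t)
    (hd : ∀ x ∈ polyhedron a b, Module.finrank ℝ (tightDirection a b x) = d (τ x)) :
    fPoly (polyhedron a b) = ∑ t ∈ U, (X : ℤ[X]) ^ d t := by
  classical
  choose! p hpP hpτ using fun t (ht : t ∈ U) => (hU t).1 ht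
  have hfaces : ∀ i, polytopeFaces (polyhedron a b) i
      = (fun t => tightFace a b (p t)) '' ((U.filter fun t => d t = i : Finset T) : Set T) := by
    intro i
    ext F
    simp only [polytopeFaces, Set.mem_ofPred_eq, Set.mem_image, Finset.coe_filter]
    constructor
    · rintro ⟨hne, hF, hdim⟩
      obtain ⟨x, hx, rfl⟩ := exists_eq_tightFace hne hF
      have hxU : τ x ∈ U := (hU _).2 ⟨x, hx, rfl⟩
      refine ⟨τ x, ⟨hxU, ?_⟩, ?_⟩
      · rw [← hdim, vectorSpan_tightFace hx, hd x hx]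
      · exact (tightFace_eq_iff (hpP _ hxU) hx).2 ((hτ _ (hpP _ hxU) _ hx).1 (hpτ _ hxU))
    · rintro ⟨t, ⟨ht, hdt⟩, rfl⟩
      refine ⟨⟨_, self_mem_tightFace (hpP t ht)⟩, tightFace_isExposed (hpP t ht), ?_⟩
      rw [vectorSpan_tightFace (hpP t ht), hd _ (hpP t ht), hpτ t ht, hdt]
  have hcard : ∀ i, (polytopeFaces (polyhedron a b) i).ncard = (U.filter fun t => d t = i).card := by
    intro i
    rw [hfaces, Set.InjOn.ncard_image, Set.ncard_coe_finset]
    intro s hs t ht hst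
    simp only [Finset.coe_filter, Set.mem_ofPred_eq] at hs ht
    rw [← hpτ s hs.1, ← hpτ t ht.1]
    exact (hτ _ (hpP s hs.1) _ (hpP t ht.1)).2
      ((tightFace_eq_iff (hpP s hs.1) (hpP t ht.1)).1 hst)
  -- `fPoly` stops at the dimension of the whole polyhedron, so no face may be lost beyond it.
  have hmaps : ∀ t ∈ U,
      d t ∈ Finset.range (Module.finrank ℝ (vectorSpan ℝ (polyhedron a b)) + 1) := by
    intro t ht
    rw [Finset.mem_range, Nat.lt_succ_iff, ← hpτ t ht, ← hd _ (hpP t ht),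
      ← vectorSpan_tightFace (hpP t ht)]
    exact Submodule.finrank_mono (vectorSpan_mono ℝ fun _ h => h.1)
  rw [fPoly, ← Finset.sum_fiberwise_of_maps_to hmaps]
  refine Finset.sum_congr rfl fun i _ => ?_
  rw [hcard, Finset.sum_congr rfl fun t ht => by rw [(Finset.mem_filter.1 ht).2],
    Finset.sum_const, nsmul_eq_mul]
  simp

end Polyhedron

/-! ### Dimensions of spaces cut out by coordinate sums -/

section Submodule

variable {V : Type*} [AddCommGroup V] [Module ℝ V] [FiniteDimensional ℝ V]

theorem finrank_inf_ker_add_one {K : Submodule ℝ V} {f : V →ₗ[ℝ] ℝ} {v : V} (hv : v ∈ K)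
    (hfv : f v ≠ 0) :
    Module.finrank ℝ (K ⊓ LinearMap.ker f : Submodule ℝ V) + 1 = Module.finrank ℝ K := by
  have hne : f.domRestrict K ≠ 0 := fun h => hfv (LinearMap.congr_fun h ⟨v, hv⟩)
  rw [← Module.Dual.finrank_ker_add_one_of_ne_zero hne]
  congr 1
  have : (LinearMap.ker (f.domRestrict K)).map K.subtype = K ⊓ LinearMap.ker f := by
    ext w
    simp [and_comm]
  rw [← this]
  exact Submodule.finrank_map_subtype_eq _ _

end Submodule

/-- The sum of the coordinates in `A`, as a linear functional. -/
def sumOn {n : ℕ} (A : Finset (Fin n)) : (Fin n → ℝ) →ₗ[ℝ] ℝ :=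
  ∑ i ∈ A, LinearMap.proj i

theorem sumOn_apply {n : ℕ} (A : Finset (Fin n)) (x : Fin n → ℝ) : sumOn A x = ∑ i ∈ A, x i := by
  simp [sumOn]

theorem sumOn_single {n : ℕ} (A : Finset (Fin n)) (i : Fin n) :
    sumOn A (Pi.single i 1) = if i ∈ A then 1 else 0 := by
  simp [sumOn_apply, Pi.single_apply]

/-- The vectors supported on `W`. -/
noncomputable def supportedOn {n : ℕ} (W : Finset (Fin n)) : Submodule ℝ (Fin n → ℝ) :=
  Pi.spanSubset ℝ (W : Set (Fin n))

theorem mem_supportedOn {n : ℕ} {W : Finset (Fin n)} {x : Fin n → ℝ} :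
    x ∈ supportedOn W ↔ ∀ i, i ∉ W → x i = 0 := by
  simp [supportedOn, Pi.mem_spanSubset_iff]

theorem single_mem_supportedOn {n : ℕ} {W : Finset (Fin n)} {i : Fin n} (hi : i ∈ W) :
    Pi.single i (1 : ℝ) ∈ supportedOn W :=
  mem_supportedOn.2 fun j hj => Pi.single_eq_of_ne (by rintro rfl; exact hj hi) _

theorem finrank_supportedOn {n : ℕ} (W : Finset (Fin n)) :
    Module.finrank ℝ (supportedOn W) = W.card := by
  rw [supportedOn, Pi.dim_spanSubset, Set.ncard_coe_finset]

theorem sumOn_eq_zero_of_disjoint {n : ℕ} {W A : Finset (Fin n)} (h : W ∩ A = ∅) {x : Fin n → ℝ}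
    (hx : x ∈ supportedOn W) : sumOn A x = 0 := by
  rw [sumOn_apply]
  refine Finset.sum_eq_zero fun i hi => mem_supportedOn.1 hx i fun hW => ?_
  have := Finset.mem_inter.2 ⟨hW, hi⟩
  rw [h] at this
  exact Finset.notMem_empty _ this

/-- The functional costs one dimension unless it vanishes on the space, which happens when W ∩ A is
empty; the truncated subtraction covers that case. -/
theorem finrank_supportedOn_inf_ker {n : ℕ} (W A : Finset (Fin n)) :
    Module.finrank ℝ (supportedOn W ⊓ LinearMap.ker (sumOn A) : Submodule ℝ (Fin n → ℝ))
      = (W \ A).card + ((W ∩ A).card - 1) := by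
  have hcard := Finset.card_sdiff_add_card_inter W A
  rcases (W ∩ A).eq_empty_or_nonempty with he | ⟨i, hi⟩
  · rw [inf_eq_left.2 fun x hx => sumOn_eq_zero_of_disjoint he hx, finrank_supportedOn]
    rw [he, Finset.card_empty] at hcard ⊢
    omega
  · have := Finset.card_pos.2 ⟨i, hi⟩
    rw [Finset.mem_inter] at hi
    have h := finrank_inf_ker_add_one (f := sumOn A) (single_mem_supportedOn hi.1)
      (by rw [sumOn_single, if_pos hi.2]; exact one_ne_zero)
    rw [finrank_supportedOn] at h
    omega

theorem finrank_supportedOn_inf_ker_inf_ker {n : ℕ} (W S : Finset (Fin n)) :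
    Module.finrank ℝ (supportedOn W ⊓ LinearMap.ker (sumOn S) ⊓ LinearMap.ker (sumOn Sᶜ) :
      Submodule ℝ (Fin n → ℝ)) = ((W ∩ S).card - 1) + ((W \ S).card - 1) := by
  have h1 := finrank_supportedOn_inf_ker W S
  rcases (W \ S).eq_empty_or_nonempty with he | ⟨i, hi⟩
  · rw [inf_eq_left.2 fun x hx => sumOn_eq_zero_of_disjoint
      (by rw [← Finset.sdiff_eq_inter_compl, he]) hx.1, h1, he]
    simp
  · have := Finset.card_pos.2 ⟨i, hi⟩
    rw [Finset.mem_sdiff] at hi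
    have h := finrank_inf_ker_add_one (K := supportedOn W ⊓ LinearMap.ker (sumOn S))
      (f := sumOn Sᶜ) ⟨single_mem_supportedOn hi.1, by
        change sumOn S _ = 0; rw [sumOn_single, if_neg hi.2]⟩
      (by rw [sumOn_single, if_pos (Finset.mem_compl.2 hi.2)]; exact one_ne_zero)
    omega

theorem sumOn_add_sumOn_compl {n : ℕ} (S : Finset (Fin n)) (x : Fin n → ℝ) :
    sumOn S x + sumOn Sᶜ x = sumOn Finset.univ x := by
  simp only [sumOn_apply]
  exact Finset.sum_add_sum_compl S x

/-! ### Types and dimensions of the faces of a truncated hypersimplex -/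

/-- The part of the hypersimplex, given by inequalities, where the sum of the coordinates in `S`
is at most `r`. -/
def slab {n : ℕ} (k : ℕ) (S : Finset (Fin n)) (r : ℕ) : Set (Fin n → ℝ) :=
  {x | (∀ i, 0 ≤ x i) ∧ (∀ i, x i ≤ 1) ∧ ∑ i, x i = k ∧ ∑ i ∈ S, x i ≤ r}

/-- The left-hand sides of the inequalities that define `slab`. -/
def slabForm {n : ℕ} (S : Finset (Fin n)) : (Fin n ⊕ Fin n) ⊕ Fin 3 → (Fin n → ℝ) →ₗ[ℝ] ℝ :=
  Sum.elim (Sum.elim (fun i => -LinearMap.proj i) fun i => LinearMap.proj i)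
    ![sumOn Finset.univ, -sumOn Finset.univ, sumOn S]

/-- The right-hand sides of the inequalities that define `slab`. -/
def slabBound (n k r : ℕ) : (Fin n ⊕ Fin n) ⊕ Fin 3 → ℝ :=
  Sum.elim (Sum.elim (fun _ => 0) fun _ => 1) ![k, -k, r]

theorem polyhedron_slabForm {n : ℕ} (k : ℕ) (S : Finset (Fin n)) (r : ℕ) :
    polyhedron (slabForm S) (slabBound n k r) = slab k S r := by
  ext x
  simp only [polyhedron, slab, Set.mem_ofPred_eq, Sum.forall, Fin.forall_fin_succ, slabForm, slabBound,
    Sum.elim_inl, Sum.elim_inr, LinearMap.neg_apply, LinearMap.proj_apply, Matrix.cons_val_zero,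
    Matrix.cons_val_succ, sumOn_apply, IsEmpty.forall_iff, and_true]
  constructor
  · rintro ⟨⟨h0, h1⟩, h2, h3, h4⟩
    exact ⟨fun i => by linarith [h0 i], h1, by linarith, h4⟩
  · rintro ⟨h0, h1, h2, h3⟩
    exact ⟨⟨fun i => by linarith [h0 i], h1⟩, h2.le, by linarith, h3⟩

open Classical in
/-- The coordinates where `x` is `1`, those where it is `0`, and whether the sum over `S` is `r`. -/
noncomputable def slabType {n : ℕ} (S : Finset (Fin n)) (r : ℕ) (x : Fin n → ℝ) :
    Finset (Fin n) × Finset (Fin n) × Bool :=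
  (Finset.univ.filter fun i => x i = 1, Finset.univ.filter fun i => x i = 0,
    decide (∑ i ∈ S, x i = r))

theorem slabType_eq_iff {n r : ℕ} {S I J : Finset (Fin n)} {β : Bool} {x : Fin n → ℝ} :
    slabType S r x = (I, J, β) ↔
      (∀ i, x i = 1 ↔ i ∈ I) ∧ (∀ i, x i = 0 ↔ i ∈ J) ∧ (∑ i ∈ S, x i = r ↔ β = true) := by
  simp only [slabType, Prod.mk.injEq, Finset.ext_iff, Finset.mem_filter, Finset.mem_univ, true_and]
  cases β <;> simp

/-- The two inequalities fixing the total sum are tight everywhere and so distinguish no faces. -/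
theorem slabType_eq_slabType_iff {n k r : ℕ} {S : Finset (Fin n)} {x y : Fin n → ℝ}
    (hx : x ∈ slab k S r) (hy : y ∈ slab k S r) :
    slabType S r x = slabType S r y ↔
      ∀ i, slabForm S i x = slabBound n k r i ↔ slabForm S i y = slabBound n k r i := by
  obtain ⟨-, -, hx, -⟩ := hx
  obtain ⟨-, -, hy, -⟩ := hy
  simp only [Sum.forall, Fin.forall_fin_succ, slabForm, slabBound,
    Sum.elim_inl, Sum.elim_inr, LinearMap.neg_apply, LinearMap.proj_apply, Matrix.cons_val_zero,
    Matrix.cons_val_succ, sumOn_apply, IsEmpty.forall_iff, and_true, hx, hy, true_and,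
    slabType, Prod.mk.injEq, Finset.ext_iff, Finset.mem_filter, Finset.mem_univ, neg_eq_zero,
    decide_eq_decide]
  tauto

theorem mem_tightDirection_slab {n k r : ℕ} {S I J : Finset (Fin n)} {β : Bool} {x v : Fin n → ℝ}
    (hx : x ∈ slab k S r) (hτ : slabType S r x = (I, J, β)) :
    v ∈ tightDirection (slabForm S) (slabBound n k r) x ↔
      v ∈ supportedOn (I ∪ J)ᶜ ∧ sumOn Finset.univ v = 0 ∧ (β = true → sumOn S v = 0) := by
  obtain ⟨-, -, hx, -⟩ := hx
  obtain ⟨hI, hJ, hβ⟩ := (slabType_eq_iff).1 hτ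
  change (∀ i, slabForm S i x = slabBound n k r i → slabForm S i v = 0) ↔ _
  simp only [Sum.forall, Fin.forall_fin_succ, slabForm, slabBound,
    Sum.elim_inl, Sum.elim_inr, LinearMap.neg_apply, LinearMap.proj_apply, Matrix.cons_val_zero,
    Matrix.cons_val_succ, sumOn_apply, IsEmpty.forall_iff, and_true, hx, 
    neg_eq_zero, hI, hJ, hβ, mem_supportedOn, Finset.mem_compl, Finset.mem_union, not_not,
    forall_const, or_imp, forall_and]
  tauto

theorem finrank_tightDirection_slab {n k r : ℕ} {S I J : Finset (Fin n)} {β : Bool}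
    {x : Fin n → ℝ} (hx : x ∈ slab k S r) (hτ : slabType S r x = (I, J, β)) :
    Module.finrank ℝ (tightDirection (slabForm S) (slabBound n k r) x) =
      if β then ((I ∪ J)ᶜ ∩ S).card - 1 + (((I ∪ J)ᶜ \ S).card - 1)
      else ((I ∪ J)ᶜ ∩ S).card + ((I ∪ J)ᶜ \ S).card - 1 := by
  cases β
  · have : tightDirection (slabForm S) (slabBound n k r) x =
        supportedOn (I ∪ J)ᶜ ⊓ LinearMap.ker (sumOn Finset.univ) := by
      ext v
      rw [mem_tightDirection_slab hx hτ]
      simp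
    rw [this, finrank_supportedOn_inf_ker, add_comm (Finset.card (_ ∩ S)),
      Finset.card_sdiff_add_card_inter]
    simp
  · have : tightDirection (slabForm S) (slabBound n k r) x =
        supportedOn (I ∪ J)ᶜ ⊓ LinearMap.ker (sumOn S) ⊓ LinearMap.ker (sumOn Sᶜ) := by
      ext v
      -- Vanishing of the total and of the S-sum is traded for vanishing on S and on its complement,
      -- two functionals with disjoint supports.
      rw [mem_tightDirection_slab hx hτ, ← sumOn_add_sumOn_compl S]
      simp only [Submodule.mem_inf, LinearMap.mem_ker, forall_const, and_assoc]
      refine and_congr_right fun _ => ⟨fun h => ⟨h.2, ?_⟩, fun h => ⟨?_, h.1⟩⟩ <;> linarith [h.1, h.2]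
    rw [this, finrank_supportedOn_inf_ker_inf_ker]
    simp

/-! ### The hypersimplex by inequalities -/

section Hypersimplex

variable {n : ℕ}

theorem mem_hypersimplex_of_zero_or_one {k : ℕ} {x : Fin n → ℝ} (hx : ∀ i, x i = 0 ∨ x i = 1)
    (hsum : ∑ i, x i = k) : x ∈ hypersimplex k n := by
  classical
  have hind : x = fun i => if i ∈ Finset.univ.filter (fun i => x i = 1) then 1 else 0 := by
    ext i
    rcases hx i with h | h <;> simp [h]
  refine subset_convexHull ℝ _ ⟨Finset.univ.filter fun i => x i = 1, ?_, hind⟩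
  rw [hind] at hsum
  rw [Finset.sum_boole, Finset.filter_mem_eq_inter, Finset.univ_inter] at hsum
  exact_mod_cast hsum

/-- A point of the unit cube with two fractional coordinates can be moved in the direction of their
difference until one of them is integral. -/
theorem exists_shift_card_fractional_lt {x : Fin n → ℝ} (h0 : ∀ m, 0 ≤ x m) (h1 : ∀ m, x m ≤ 1)
    {i j : Fin n} (hij : i ≠ j) (hi0 : x i ≠ 0) (hi : x i ≠ 1) (hj0 : x j ≠ 0) (hj : x j ≠ 1) :
    ∃ t : ℝ, 0 < t ∧ ∃ y : Fin n → ℝ, y = x + t • (Pi.single i 1 - Pi.single j 1) ∧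
      (∀ m, 0 ≤ y m) ∧ (∀ m, y m ≤ 1) ∧ ∑ m, y m = ∑ m, x m ∧
      (Finset.univ.filter fun m => y m ≠ 0 ∧ y m ≠ 1).card <
        (Finset.univ.filter fun m => x m ≠ 0 ∧ x m ≠ 1).card := by
  have hi1 : x i < 1 := lt_of_le_of_ne (h1 i) hi
  have hj1 : 0 < x j := lt_of_le_of_ne (h0 j) hj0.symm
  -- The longest step that stays in the cube: coordinate i reaches 1 or coordinate j reaches 0.
  set t := min (1 - x i) (x j) with ht
  have htpos : 0 < t := lt_min (by linarith) hj1
  have hti : t ≤ 1 - x i := min_le_left _ _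
  have htj : t ≤ x j := min_le_right _ _
  refine ⟨t, htpos, _, rfl, ?_⟩
  set y : Fin n → ℝ := x + t • (Pi.single i 1 - Pi.single j 1) with hy
  have yi : y i = x i + t := by simp [hy, hij]
  have yj : y j = x j - t := by simp [hy, hij.symm, sub_eq_add_neg]
  have ym : ∀ m, m ≠ i → m ≠ j → y m = x m := fun m hmi hmj => by simp [hy, hmi, hmj]
  refine ⟨fun m => ?_, fun m => ?_, ?_, ?_⟩
  · by_cases hmi : m = i
    · rw [hmi, yi]; linarith [h0 i]
    by_cases hmj : m = j
    · rw [hmj, yj]; linarith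
    rw [ym m hmi hmj]; exact h0 m
  · by_cases hmi : m = i
    · rw [hmi, yi]; linarith
    by_cases hmj : m = j
    · rw [hmj, yj]; linarith [h1 j]
    rw [ym m hmi hmj]; exact h1 m
  · simp [hy, Finset.sum_add_distrib, ← Finset.mul_sum]
  · refine Finset.card_lt_card ⟨fun m hm => ?_, fun hsub => ?_⟩
    · simp only [Finset.mem_filter, Finset.mem_univ, true_and] at hm ⊢
      by_cases hmi : m = i
      · rw [hmi]; exact ⟨hi0, hi⟩
      by_cases hmj : m = j
      · rw [hmj]; exact ⟨hj0, hj⟩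
      rwa [ym m hmi hmj] at hm
    · have h2 := hsub (Finset.mem_filter.2 ⟨Finset.mem_univ i, hi0, hi⟩)
      have h3 := hsub (Finset.mem_filter.2 ⟨Finset.mem_univ j, hj0, hj⟩)
      simp only [Finset.mem_filter, Finset.mem_univ, true_and, yi, yj] at h2 h3
      rcases min_choice (1 - x i) (x j) with h | h
      · exact h2.2 (by rw [ht, h]; ring)
      · exact h3.1 (by rw [ht, h]; ring)

/-- Induction on the number of fractional coordinates. If there are any there are at least two, and
shifting between them in both directions exhibits x as a convex combination of points with fewer. -/
theorem mem_hypersimplex_of_sum_eq {k : ℕ} (N : ℕ) : ∀ x : Fin n → ℝ, (∀ i, 0 ≤ x i) →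
    (∀ i, x i ≤ 1) → ∑ i, x i = k →
    (Finset.univ.filter fun m => x m ≠ 0 ∧ x m ≠ 1).card = N → x ∈ hypersimplex k n := by
  classical
  induction N using Nat.strong_induction_on with
  | _ N ih =>
    intro x h0 h1 hsum hN
    by_cases hint : ∀ i, x i = 0 ∨ x i = 1
    · exact mem_hypersimplex_of_zero_or_one hint hsum
    push Not at hint
    obtain ⟨i, hi0, hi1⟩ := hint
    obtain ⟨j, hji, hj0, hj1⟩ : ∃ j, j ≠ i ∧ x j ≠ 0 ∧ x j ≠ 1 := by
      -- With a single fractional coordinate, k would lie strictly between consecutive integers.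
      by_contra! hcon
      have hrest : ∑ m ∈ Finset.univ.erase i, x m
          = ((Finset.univ.erase i).filter fun m => x m = 1).card := by
        rw [← Finset.sum_boole]
        refine Finset.sum_congr rfl fun m hm => ?_
        by_cases hm0 : x m = 0
        · simp [hm0]
        · simp [hcon m (Finset.ne_of_mem_erase hm) hm0]
      rw [← Finset.add_sum_erase _ _ (Finset.mem_univ i), hrest] at hsum
      have h2 := lt_of_le_of_ne (h0 i) hi0.symm
      have h3 := lt_of_le_of_ne (h1 i) hi1
      have h4 : (((Finset.univ.erase i).filter fun m => x m = 1).card : ℝ) < k := by linarith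
      have h5 : (k : ℝ) < (((Finset.univ.erase i).filter fun m => x m = 1).card : ℝ) + 1 := by
        linarith
      have h4' := Nat.cast_lt.1 h4
      have h5' : k < ((Finset.univ.erase i).filter fun m => x m = 1).card + 1 := by
        exact_mod_cast h5
      omega
    obtain ⟨t, ht, y, hy, y0, y1, ysum, ycard⟩ :=
      exists_shift_card_fractional_lt h0 h1 hji.symm hi0 hi1 hj0 hj1
    obtain ⟨s, hs, z, hz, z0, z1, zsum, zcard⟩ :=
      exists_shift_card_fractional_lt h0 h1 hji hj0 hj1 hi0 hi1
    have hyP := ih _ (hN ▸ ycard) y y0 y1 (ysum.trans hsum) rfl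
    have hzP := ih _ (hN ▸ zcard) z z0 z1 (zsum.trans hsum) rfl
    have hst : 0 < s + t := add_pos hs ht
    -- y and z are displaced from x in opposite directions, by t and by s.
    have hcomb : x = (s / (s + t)) • y + (t / (s + t)) • z := by
      ext m
      simp only [hy, hz, Pi.add_apply, Pi.smul_apply, Pi.sub_apply, smul_eq_mul]
      field_simp
      ring
    rw [hcomb]
    exact convex_convexHull ℝ _ hyP hzP (by positivity) (by positivity)
      (by field_simp)

theorem mem_hypersimplex_iff {k : ℕ} {x : Fin n → ℝ} :
    x ∈ hypersimplex k n ↔ (∀ i, 0 ≤ x i) ∧ (∀ i, x i ≤ 1) ∧ ∑ i, x i = k := by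
  refine ⟨fun hx => ?_, fun ⟨h0, h1, h⟩ => mem_hypersimplex_of_sum_eq _ x h0 h1 h rfl⟩
  have hconv : Convex ℝ {x : Fin n → ℝ | (∀ i, 0 ≤ x i) ∧ (∀ i, x i ≤ 1) ∧ ∑ i, x i = k} := by
    rintro x ⟨x0, x1, xs⟩ y ⟨y0, y1, ys⟩ s t hs ht hst
    refine ⟨fun i => ?_, fun i => ?_, ?_⟩
    · have := mul_nonneg hs (x0 i)
      have := mul_nonneg ht (y0 i)
      simp only [Pi.add_apply, Pi.smul_apply, smul_eq_mul]
      linarith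
    · have := mul_le_mul_of_nonneg_left (x1 i) hs
      have := mul_le_mul_of_nonneg_left (y1 i) ht
      simp only [Pi.add_apply, Pi.smul_apply, smul_eq_mul]
      linarith
    · simp only [Pi.add_apply, Pi.smul_apply, smul_eq_mul, Finset.sum_add_distrib,
        ← Finset.mul_sum, xs, ys]
      rw [← add_mul, hst, one_mul]
  refine convexHull_min ?_ hconv hx
  rintro _ ⟨B, hB, rfl⟩
  refine ⟨fun i => ?_, fun i => ?_, ?_⟩
  · dsimp only; split_ifs <;> norm_num
  · dsimp only; split_ifs <;> norm_num
  · simp [hB]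

/-- The extra inequality reads 0 ≤ 1. The bound 1 instead of 0 keeps it from ever being tight. -/
theorem hypersimplex_eq_slab (k n : ℕ) : hypersimplex k n = slab k ∅ 1 := by
  ext x
  rw [mem_hypersimplex_iff]
  simp [slab]

theorem schubertPolytope_eq_slab (r k h n : ℕ) :
    schubertPolytope r k h n = slab k (Finset.univ.filter fun i : Fin n => i.val < h) r := by
  ext x
  simp only [schubertPolytope, Set.mem_ofPred_eq, mem_hypersimplex_iff, slab, and_assoc]

end Hypersimplex

/-! ### Which types occur -/

/-- `s` is a sum of `a` real numbers strictly between `0` and `1`. -/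
def IsFractionalSum (a : ℕ) (s : ℝ) : Prop :=
  (a = 0 ∧ s = 0) ∨ (0 < s ∧ s < a)

section Realization

variable {n : ℕ} {I J : Finset (Fin n)}

theorem sum_eq_card_inter_add_sum {x : Fin n → ℝ} (hI : ∀ i, x i = 1 ↔ i ∈ I)
    (hJ : ∀ i, x i = 0 ↔ i ∈ J) (A : Finset (Fin n)) :
    ∑ i ∈ A, x i = (I ∩ A).card + ∑ i ∈ (I ∪ J)ᶜ ∩ A, x i := by
  rw [Finset.inter_comm _ A, Finset.inter_comm _ A, ← Finset.sum_ite_mem, Finset.card_eq_sum_ones, Nat.cast_sum,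
    ← Finset.sum_ite_mem, ← Finset.sum_add_distrib]
  refine Finset.sum_congr rfl fun i _ => ?_
  by_cases h1 : i ∈ I
  · simp [h1, (hI i).2 h1]
  · by_cases h2 : i ∈ J
    · simp [h1, h2, (hJ i).2 h2]
    · simp [h1, h2]

theorem isFractionalSum_sum {x : Fin n → ℝ} (h0 : ∀ i, 0 ≤ x i) (h1 : ∀ i, x i ≤ 1)
    (hI : ∀ i, x i = 1 ↔ i ∈ I) (hJ : ∀ i, x i = 0 ↔ i ∈ J) (A : Finset (Fin n)) :
    IsFractionalSum ((I ∪ J)ᶜ ∩ A).card (∑ i ∈ (I ∪ J)ᶜ ∩ A, x i) := by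
  rcases ((I ∪ J)ᶜ ∩ A).eq_empty_or_nonempty with he | hne
  · rw [he]; exact Or.inl ⟨rfl, rfl⟩
  · have hW : ∀ i ∈ (I ∪ J)ᶜ ∩ A, x i ≠ 0 ∧ x i ≠ 1 := fun i hi => by
      simp only [Finset.mem_inter, Finset.mem_compl, Finset.mem_union, not_or] at hi
      exact ⟨fun h => hi.1.2 ((hJ i).1 h), fun h => hi.1.1 ((hI i).1 h)⟩
    refine Or.inr ⟨Finset.sum_pos (fun i hi => lt_of_le_of_ne (h0 i) (hW i hi).1.symm) hne, ?_⟩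
    calc ∑ i ∈ (I ∪ J)ᶜ ∩ A, x i < ∑ i ∈ (I ∪ J)ᶜ ∩ A, 1 :=
          Finset.sum_lt_sum_of_nonempty hne fun i hi => lt_of_le_of_ne (h1 i) (hW i hi).2
      _ = _ := by simp

theorem IsFractionalSum.div_pos_lt_one {a : ℕ} {s : ℝ} (h : IsFractionalSum a s) (ha : a ≠ 0) :
    0 < s / a ∧ s / a < 1 := by
  obtain ⟨h, -⟩ | ⟨h0, h1⟩ := h
  · exact absurd h ha
  · have : (0 : ℝ) < a := by positivity
    exact ⟨by positivity, (div_lt_one this).2 h1⟩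

theorem IsFractionalSum.mul_div_self {a : ℕ} {s : ℝ} (h : IsFractionalSum a s) :
    (a : ℝ) * (s / a) = s := by
  rcases eq_or_ne a 0 with rfl | ha
  · obtain ⟨-, rfl⟩ | ⟨h0, h1⟩ := h
    · simp
    · rw [Nat.cast_zero] at h1; linarith
  · field_simp

/-- Only the sums s and s' of the free coordinates inside and outside S matter: conversely, giving
those coordinates the common values s / a and s' / c realizes the type. -/
theorem exists_slabType_eq_iff {k r : ℕ} {S : Finset (Fin n)} {β : Bool} :
    (∃ x ∈ slab k S r, slabType S r x = (I, J, β)) ↔ Disjoint I J ∧ ∃ s s' : ℝ,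
      IsFractionalSum ((I ∪ J)ᶜ ∩ S).card s ∧ IsFractionalSum ((I ∪ J)ᶜ \ S).card s' ∧
      (I ∩ S).card + s + ((I \ S).card + s') = k ∧ (I ∩ S).card + s ≤ r ∧
      ((I ∩ S).card + s = r ↔ β = true) := by
  simp only [Finset.sdiff_eq_inter_compl]
  constructor
  · rintro ⟨x, ⟨h0, h1, hk, hr⟩, hτ⟩
    obtain ⟨hI, hJ, hβ⟩ := slabType_eq_iff.1 hτ
    refine ⟨Finset.disjoint_left.2 fun i h1 h2 => ?_, _, _, isFractionalSum_sum h0 h1 hI hJ S,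
      isFractionalSum_sum h0 h1 hI hJ Sᶜ, ?_⟩
    · have := (hI i).2 h1
      rw [(hJ i).2 h2] at this
      exact zero_ne_one this
    · rw [← sum_eq_card_inter_add_sum hI hJ, ← sum_eq_card_inter_add_sum hI hJ,
        Finset.sum_add_sum_compl]
      exact ⟨hk, hr, hβ⟩
  · rintro ⟨hdisj, s, s', hs, hs', hk, hr, hβ⟩
    set a := ((I ∪ J)ᶜ ∩ S).card with ha
    set c := ((I ∪ J)ᶜ ∩ Sᶜ).card with hc
    set x : Fin n → ℝ := fun i => if i ∈ I then 1 else if i ∈ J then 0 else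
      if i ∈ S then s / a else s' / c with hx
    have hxI : ∀ i ∈ I, x i = 1 := fun i hi => by simp [hx, hi]
    have hxJ : ∀ i ∈ J, x i = 0 := fun i hi => by
      simp [hx, hi, Finset.disjoint_right.1 hdisj hi]
    have hxS : ∀ i ∈ (I ∪ J)ᶜ ∩ S, x i = s / a := fun i hi => by
      simp only [Finset.mem_inter, Finset.mem_compl, Finset.mem_union, not_or] at hi
      simp [hx, hi.1.1, hi.1.2, hi.2]
    have hxS' : ∀ i ∈ (I ∪ J)ᶜ ∩ Sᶜ, x i = s' / c := fun i hi => by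
      simp only [Finset.mem_inter, Finset.mem_compl, Finset.mem_union, not_or] at hi
      simp [hx, hi.1.1, hi.1.2, hi.2]
    have hfrac : ∀ i, i ∉ I → i ∉ J → 0 < x i ∧ x i < 1 := by
      intro i h1 h2
      by_cases hiS : i ∈ S
      · have hi : i ∈ (I ∪ J)ᶜ ∩ S := by simp [h1, h2, hiS]
        rw [hxS i hi]
        exact hs.div_pos_lt_one (Finset.card_ne_zero_of_mem hi)
      · have hi : i ∈ (I ∪ J)ᶜ ∩ Sᶜ := by simp [h1, h2, hiS]
        rw [hxS' i hi]
        exact hs'.div_pos_lt_one (Finset.card_ne_zero_of_mem hi)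
    have hI : ∀ i, x i = 1 ↔ i ∈ I := fun i => by
      refine ⟨fun h => by_contra fun h1 => ?_, hxI i⟩
      by_cases h2 : i ∈ J
      · rw [hxJ i h2] at h; exact zero_ne_one h
      · exact (hfrac i h1 h2).2.ne h
    have hJ : ∀ i, x i = 0 ↔ i ∈ J := fun i => by
      refine ⟨fun h => by_contra fun h2 => ?_, hxJ i⟩
      by_cases h1 : i ∈ I
      · rw [hxI i h1] at h; exact one_ne_zero h
      · exact (hfrac i h1 h2).1.ne' h
    have hcube : ∀ i, 0 ≤ x i ∧ x i ≤ 1 := fun i => by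
      by_cases h1 : i ∈ I
      · rw [hxI i h1]; norm_num
      by_cases h2 : i ∈ J
      · rw [hxJ i h2]; norm_num
      exact ⟨(hfrac i h1 h2).1.le, (hfrac i h1 h2).2.le⟩
    have hsum : ∑ i ∈ S, x i = (I ∩ S).card + s := by
      rw [sum_eq_card_inter_add_sum hI hJ, Finset.sum_congr rfl hxS, Finset.sum_const,
        nsmul_eq_mul, hs.mul_div_self]
    have hsum' : ∑ i ∈ Sᶜ, x i = (I ∩ Sᶜ).card + s' := by
      rw [sum_eq_card_inter_add_sum hI hJ, Finset.sum_congr rfl hxS', Finset.sum_const,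
        nsmul_eq_mul, hs'.mul_div_self]
    refine ⟨x, ⟨fun i => (hcube i).1, fun i => (hcube i).2, ?_, hsum ▸ hr⟩, ?_⟩
    · rw [← Finset.sum_add_sum_compl S, hsum, hsum', hk]
    · exact slabType_eq_iff.2 ⟨hI, hJ, hsum ▸ hβ⟩

end Realization

/-- Faces off the hyperplane. Since s' = k - i - l - s, the question is whether an interval for s is
nonempty; it is open when a and c are positive. -/
theorem exists_isFractionalSum_lt_iff {r k i l a c : ℕ} :
    (∃ s s' : ℝ, IsFractionalSum a s ∧ IsFractionalSum c s' ∧ (i : ℝ) + s + (l + s') = k ∧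
      (i : ℝ) + s < r) ↔
    ((a + c = 0 ∧ i + l = k) ∨ (i + l < k ∧ k < i + l + a + c)) ∧ i < r ∧ k < r + l + c := by
  constructor
  · rintro ⟨s, s', ⟨rfl, rfl⟩ | ⟨hs0, hsa⟩, ⟨rfl, rfl⟩ | ⟨hs0', hsc⟩, hk, hr⟩
    · have h1 : i + l = k := by exact_mod_cast (by linarith : (i : ℝ) + l = k)
      have h2 : i < r := by exact_mod_cast (by linarith : (i : ℝ) < r)
      omega
    · have h1 : i + l < k := by exact_mod_cast (by linarith : (i : ℝ) + l < k)
      have h2 : i < r := by exact_mod_cast (by linarith : (i : ℝ) < r)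
      have h3 : k < i + l + c := by exact_mod_cast (by linarith : (k : ℝ) < i + l + c)
      omega
    · have h1 : i + l < k := by exact_mod_cast (by linarith : (i : ℝ) + l < k)
      have h2 : k < r + l := by exact_mod_cast (by linarith : (k : ℝ) < r + l)
      have h3 : k < i + l + a := by exact_mod_cast (by linarith : (k : ℝ) < i + l + a)
      omega
    · have h1 : i + l < k := by exact_mod_cast (by linarith : (i : ℝ) + l < k)
      have h2 : k < r + l + c := by exact_mod_cast (by linarith : (k : ℝ) < r + l + c)
      have h3 : k < i + l + a + c := by exact_mod_cast (by linarith : (k : ℝ) < i + l + a + c)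
      have h4 : i < r := by exact_mod_cast (by linarith : (i : ℝ) < r)
      omega
  · rintro ⟨hΔ, hir, hk⟩
    rcases Nat.eq_zero_or_pos a with rfl | ha
    · refine ⟨0, k - i - l, Or.inl ⟨rfl, rfl⟩, ?_, by ring, by simpa using hir⟩
      rcases hΔ with ⟨hc, rfl⟩ | ⟨h1, h2⟩
      · exact Or.inl ⟨by omega, by push_cast; ring⟩
      · have h1 : (i : ℝ) + l < k := by exact_mod_cast h1
        have h2 : (k : ℝ) < i + l + 0 + c := by exact_mod_cast h2
        exact Or.inr ⟨by linarith, by linarith⟩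
    rcases Nat.eq_zero_or_pos c with rfl | hc
    · have h1 : (i : ℝ) + l < k := by exact_mod_cast (by omega : i + l < k)
      have h2 : (k : ℝ) < i + l + a := by exact_mod_cast (by omega : k < i + l + a)
      have h3 : (k : ℝ) < r + l := by exact_mod_cast (by omega : k < r + l)
      exact ⟨k - i - l, 0, Or.inr ⟨by linarith, by linarith⟩, Or.inl ⟨rfl, rfl⟩, by ring, by linarith⟩
    · have ha' : (0 : ℝ) < a := by exact_mod_cast ha
      have hc' : (0 : ℝ) < c := by exact_mod_cast hc
      have h1 : (i : ℝ) + l < k := by exact_mod_cast (by omega : i + l < k)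
      have h2 : (k : ℝ) < i + l + a + c := by exact_mod_cast (by omega : k < i + l + a + c)
      have h3 : (k : ℝ) < r + l + c := by exact_mod_cast hk
      have h4 : (i : ℝ) < r := by exact_mod_cast hir
      obtain ⟨s, hs, hs'⟩ : ∃ s : ℝ, max 0 ((k : ℝ) - i - l - c) < s ∧
          s < min (a : ℝ) (min (k - i - l) (r - i)) := by
        refine exists_between ?_
        simp only [max_lt_iff, lt_min_iff]
        refine ⟨⟨?_, ?_⟩, ⟨?_, ?_⟩, ?_, ?_⟩ <;> linarith
      simp only [max_lt_iff, lt_min_iff] at hs hs'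
      exact ⟨s, k - i - l - s, Or.inr ⟨hs.1, hs'.1⟩,
        Or.inr ⟨by linarith, by linarith⟩, by ring, by linarith⟩

/-- Faces in the hyperplane. Now s = r - i and s' = k - r - l are forced, so the condition decouples
into one on S and one on its complement. -/
theorem exists_isFractionalSum_eq_iff {r k i l a c : ℕ} :
    (∃ s s' : ℝ, IsFractionalSum a s ∧ IsFractionalSum c s' ∧ (i : ℝ) + s + (l + s') = k ∧
      (i : ℝ) + s = r) ↔
    ((a = 0 ∧ i = r) ∨ (i < r ∧ r < i + a)) ∧ ((c = 0 ∧ r + l = k) ∨ (r + l < k ∧ k < r + l + c)) := by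
  constructor
  · rintro ⟨s, s', hs, hs', hk, hr⟩
    constructor
    · obtain ⟨rfl, rfl⟩ | ⟨h0, h1⟩ := hs
      · exact Or.inl ⟨rfl, by exact_mod_cast (by linarith : (i : ℝ) = r)⟩
      · exact Or.inr ⟨by exact_mod_cast (by linarith : (i : ℝ) < r),
          by exact_mod_cast (by linarith : (r : ℝ) < i + a)⟩
    · obtain ⟨rfl, rfl⟩ | ⟨h0, h1⟩ := hs'
      · exact Or.inl ⟨rfl, by exact_mod_cast (by linarith : (r : ℝ) + l = k)⟩
      · exact Or.inr ⟨by exact_mod_cast (by linarith : (r : ℝ) + l < k),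
          by exact_mod_cast (by linarith : (k : ℝ) < r + l + c)⟩
  · rintro ⟨h1, h2⟩
    refine ⟨r - i, k - r - l, ?_, ?_, by ring, by ring⟩
    · obtain ⟨rfl, rfl⟩ | ⟨h0, h1⟩ := h1
      · exact Or.inl ⟨rfl, by ring⟩
      · have h0 : (i : ℝ) < r := by exact_mod_cast h0
        have h1 : (r : ℝ) < i + a := by exact_mod_cast h1
        exact Or.inr ⟨by linarith, by linarith⟩
    · obtain ⟨rfl, rfl⟩ | ⟨h0, h1⟩ := h2
      · exact Or.inl ⟨rfl, by push_cast; ring⟩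
      · have h0 : (r : ℝ) + l < k := by exact_mod_cast h0
        have h1 : (k : ℝ) < r + l + c := by exact_mod_cast h1
        exact Or.inr ⟨by linarith, by linarith⟩

/-! ### The f-polynomials as sums over disjoint pairs -/

/-- The contribution to the `f`-polynomial of `Δ_{k,n}` of the face whose points have `i` coordinates
equal to `1` and `w` free coordinates. -/
noncomputable def hypersimplexTerm (k i w : ℕ) : ℤ[X] :=
  if (w = 0 ∧ i = k) ∨ (i < k ∧ k < i + w) then X ^ (w - 1) else 0

/-- The contribution to the `f`-polynomial of `slab k S r` of the faces whose points have `i`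
coordinates in `S` and `l` coordinates outside `S` equal to `1`, and `a` free coordinates in `S` and
`c` outside `S`: one face that is not contained in the hyperplane where the coordinates in `S` sum
to `r`, and one that is. -/
noncomputable def slabTerm (r k i l a c : ℕ) : ℤ[X] :=
  (if ((a + c = 0 ∧ i + l = k) ∨ (i + l < k ∧ k < i + l + a + c)) ∧ i < r ∧ k < r + l + c
    then X ^ (a + c - 1) else 0) +
  (if ((a = 0 ∧ i = r) ∨ (i < r ∧ r < i + a)) ∧
      ((c = 0 ∧ r + l = k) ∨ (r + l < k ∧ k < r + l + c))
    then X ^ (a - 1 + (c - 1)) else 0)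

theorem fPoly_slab {n : ℕ} (k : ℕ) (S : Finset (Fin n)) (r : ℕ) :
    fPoly (slab k S r) =
      ∑ p : Finset (Fin n) × Finset (Fin n) with Disjoint p.1 p.2,
        slabTerm r k (p.1 ∩ S).card (p.1 \ S).card ((p.1 ∪ p.2)ᶜ ∩ S).card
          ((p.1 ∪ p.2)ᶜ \ S).card := by
  classical
  let U : Finset (Finset (Fin n) × Finset (Fin n) × Bool) :=
    Finset.univ.filter fun t => ∃ x ∈ slab k S r, slabType S r x = t
  let d : Finset (Fin n) × Finset (Fin n) × Bool → ℕ := fun t =>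
    if t.2.2 then ((t.1 ∪ t.2.1)ᶜ ∩ S).card - 1 + (((t.1 ∪ t.2.1)ᶜ \ S).card - 1)
      else ((t.1 ∪ t.2.1)ᶜ ∩ S).card + ((t.1 ∪ t.2.1)ᶜ \ S).card - 1
  have hpoly : fPoly (slab k S r) = ∑ t ∈ U, (X : ℤ[X]) ^ d t := by
    have hP := polyhedron_slabForm k S r
    have h := fPoly_polyhedron (a := slabForm S) (b := slabBound n k r) (slabType S r) U d
    rw [hP] at h
    exact h (fun x hx y hy => slabType_eq_slabType_iff hx hy) (fun t => by simp [U])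
      fun x hx => finrank_tightDirection_slab hx rfl
  rw [hpoly, Finset.sum_filter, Finset.sum_filter, Fintype.sum_prod_type, Fintype.sum_prod_type]
  refine Finset.sum_congr rfl fun I _ => ?_
  rw [Fintype.sum_prod_type]
  refine Finset.sum_congr rfl fun J _ => ?_
  rw [Fintype.sum_bool]
  simp only [exists_slabType_eq_iff, d]
  by_cases hdisj : Disjoint I J
  · have hlt : ∀ y z : ℝ, (y ≤ z ∧ (y = z ↔ false = true)) ↔ y < z := fun y z => by
      simp [lt_iff_le_and_ne]
    have heq : ∀ y z : ℝ, (y ≤ z ∧ (y = z ↔ True)) ↔ y = z := fun y z => by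
      simp only [iff_true]
      exact ⟨fun h => h.2, fun h => ⟨h.le, h⟩⟩
    simp only [hdisj, true_and, hlt, heq, exists_isFractionalSum_lt_iff,
      exists_isFractionalSum_eq_iff, if_true, slabTerm]
    rw [add_comm]
    simp only [Bool.false_eq_true, if_false]
  · simp [hdisj]

theorem fPoly_hypersimplex (k n : ℕ) :
    fPoly (hypersimplex k n) =
      ∑ p : Finset (Fin n) × Finset (Fin n) with Disjoint p.1 p.2,
        hypersimplexTerm k p.1.card (p.1 ∪ p.2)ᶜ.card := by
  rw [hypersimplex_eq_slab, fPoly_slab]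
  refine Finset.sum_congr rfl fun p _ => ?_
  simp only [slabTerm, hypersimplexTerm, Finset.inter_empty, Finset.card_empty, Finset.sdiff_empty]
  refine (congrArg₂ (· + ·) (if_congr ?_ (by rw [zero_add]) rfl) (if_neg ?_)).trans (add_zero _)
  · omega
  · omega

/-! ### Counting disjoint pairs by cardinalities -/

section Counting

variable {n : ℕ} {M : Type*} [AddCommMonoid M]

/-- Padding with vanishing binomials lets sums over sets of different sizes share one index range,
as the final comparison requires. -/
theorem sum_powerset_apply_card_of_lt {α : Type*} (f : ℕ → M) (S : Finset α) {N : ℕ}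
    (hN : S.card < N) :
    ∑ I ∈ S.powerset, f I.card = ∑ i ∈ Finset.range N, S.card.choose i • f i := by
  rw [Finset.sum_powerset_apply_card]
  refine Finset.sum_subset (Finset.range_subset_range.2 hN) fun i _ hi => ?_
  rw [Finset.mem_range, not_lt] at hi
  rw [Nat.choose_eq_zero_of_lt (by omega), zero_smul]

/-- The pairs of disjoint subsets of `S`. -/
def disjointPairs {α : Type*} [DecidableEq α] (S : Finset α) : Finset (Finset α × Finset α) :=
  (S.powerset ×ˢ S.powerset).filter fun p => Disjoint p.1 p.2

theorem mem_disjointPairs {α : Type*} [DecidableEq α] {S : Finset α} {p : Finset α × Finset α} :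
    p ∈ disjointPairs S ↔ p.1 ⊆ S ∧ p.2 ⊆ S ∧ Disjoint p.1 p.2 := by
  simp [disjointPairs, and_assoc]

theorem sum_disjointPairs {α : Type*} [DecidableEq α] (g : ℕ → ℕ → M) (S : Finset α) {N : ℕ}
    (hN : S.card < N) :
    ∑ p ∈ disjointPairs S, g p.1.card p.2.card =
      ∑ i ∈ Finset.range N, ∑ j ∈ Finset.range N,
        (S.card.choose i * (S.card - i).choose j) • g i j := by
  have hinner : ∀ I ∈ S.powerset,
      (∑ J ∈ S.powerset, if Disjoint I J then g I.card J.card else 0) =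
        ∑ j ∈ Finset.range N, (S.card - I.card).choose j • g I.card j := by
    intro I hI
    rw [Finset.mem_powerset] at hI
    have hle := Finset.card_sdiff_of_subset hI
    rw [← Finset.sum_filter, ← hle, ← sum_powerset_apply_card_of_lt _ _ (by omega)]
    refine Finset.sum_congr ?_ fun _ _ => rfl
    ext J
    rw [Finset.mem_filter, Finset.mem_powerset, Finset.mem_powerset, Finset.subset_sdiff,
      disjoint_comm]
  rw [disjointPairs, Finset.sum_filter, Finset.sum_product, Finset.sum_congr rfl hinner,
    sum_powerset_apply_card_of_lt
      (fun i => ∑ j ∈ Finset.range N, (S.card - i).choose j • g i j) S hN]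
  simp only [Finset.smul_sum, mul_smul]

theorem sum_disjoint_split (S : Finset (Fin n))
    (F : Finset (Fin n) × Finset (Fin n) → Finset (Fin n) × Finset (Fin n) → M) :
    ∑ p : Finset (Fin n) × Finset (Fin n) with Disjoint p.1 p.2,
        F (p.1 ∩ S, p.2 ∩ S) (p.1 \ S, p.2 \ S) =
      ∑ p ∈ disjointPairs S, ∑ q ∈ disjointPairs Sᶜ, F p q := by
  rw [← Finset.sum_product']
  refine Finset.sum_nbij' (fun p => ((p.1 ∩ S, p.2 ∩ S), (p.1 \ S, p.2 \ S)))
    (fun q => (q.1.1 ∪ q.2.1, q.1.2 ∪ q.2.2)) ?_ ?_ ?_ ?_ ?_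
  · rintro ⟨I, J⟩ h
    simp only [Finset.mem_filter, Finset.mem_univ, true_and] at h
    simp only [Finset.mem_product, mem_disjointPairs]
    refine ⟨⟨Finset.inter_subset_right, Finset.inter_subset_right,
      h.mono Finset.inter_subset_left Finset.inter_subset_left⟩, ?_, ?_,
      h.mono Finset.sdiff_subset Finset.sdiff_subset⟩ <;>
    · intro i; simp
  · rintro ⟨⟨I, J⟩, ⟨I', J'⟩⟩ h
    simp only [Finset.mem_product, mem_disjointPairs] at h
    obtain ⟨⟨h1, h2, h3⟩, h4, h5, h6⟩ := h
    have hS : Disjoint S Sᶜ := disjoint_compl_right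
    simp only [Finset.mem_filter, Finset.mem_univ, true_and, Finset.disjoint_union_left,
      Finset.disjoint_union_right]
    exact ⟨⟨h3, hS.symm.mono h4 h2⟩, hS.mono h1 h5, h6⟩
  · rintro ⟨I, J⟩ h
    simp only [Prod.mk.injEq]
    constructor <;> (ext i; simp only [Finset.mem_union, Finset.mem_inter, Finset.mem_sdiff]; tauto)
  · rintro ⟨⟨I, J⟩, ⟨I', J'⟩⟩ h
    simp only [Finset.mem_product, mem_disjointPairs, Finset.subset_iff, Finset.mem_compl] at h
    obtain ⟨⟨h1, h2, h3⟩, h4, h5, h6⟩ := h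
    simp only [Prod.mk.injEq]
    refine ⟨⟨?_, ?_⟩, ?_, ?_⟩ <;>
    · ext i
      simp only [Finset.mem_union, Finset.mem_inter, Finset.mem_sdiff]
      have := @h1 i; have := @h2 i; have := @h4 i; have := @h5 i
      tauto
  · intros; rfl

theorem sum_disjoint_card (S : Finset (Fin n)) (g : ℕ → ℕ → ℕ → ℕ → M) :
    ∑ p : Finset (Fin n) × Finset (Fin n) with Disjoint p.1 p.2,
        g (p.1 ∩ S).card (p.2 ∩ S).card (p.1 \ S).card (p.2 \ S).card =
      ∑ i ∈ Finset.range (n + 1), ∑ j ∈ Finset.range (n + 1),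
        ∑ l ∈ Finset.range (n + 1), ∑ m ∈ Finset.range (n + 1),
          ((S.card.choose i * (S.card - i).choose j) *
            (Sᶜ.card.choose l * (Sᶜ.card - l).choose m)) • g i j l m := by
  have h1 : S.card < n + 1 := Nat.lt_succ_of_le ((Finset.card_le_univ S).trans (by simp))
  have h2 : Sᶜ.card < n + 1 := Nat.lt_succ_of_le ((Finset.card_le_univ Sᶜ).trans (by simp))
  rw [sum_disjoint_split S fun p q => g p.1.card p.2.card q.1.card q.2.card,
    Finset.sum_congr rfl fun p _ => sum_disjointPairs (g p.1.card p.2.card) Sᶜ h2,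
    sum_disjointPairs (fun i j => ∑ l ∈ Finset.range (n + 1), ∑ m ∈ Finset.range (n + 1),
      (Sᶜ.card.choose l * (Sᶜ.card - l).choose m) • g i j l m) S h1]
  simp only [Finset.smul_sum, mul_smul]

end Counting

theorem card_compl_union_inter {n : ℕ} {I J : Finset (Fin n)} (h : Disjoint I J)
    (A : Finset (Fin n)) :
    ((I ∪ J)ᶜ ∩ A).card = A.card - (I ∩ A).card - (J ∩ A).card := by
  have h1 : (I ∪ J)ᶜ ∩ A = A \ ((I ∩ A) ∪ (J ∩ A)) := by
    ext i
    simp only [Finset.mem_inter, Finset.mem_compl, Finset.mem_union, Finset.mem_sdiff]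
    tauto
  rw [h1, Finset.card_sdiff_of_subset (Finset.union_subset Finset.inter_subset_right
    Finset.inter_subset_right), Finset.card_union_of_disjoint
    (h.mono Finset.inter_subset_left Finset.inter_subset_left), Nat.sub_sub]

/-! ### The identity for a single face type -/

/-- On the face of the hypersimplex the S-sum ranges from max(i, k-l-c) to min(i+a, k-l). The first
indicator says that the upper end exceeds r, the product that r lies strictly between the ends. -/
theorem hypersimplexTerm_sub_slabTerm {r k i l a c : ℕ} (hrk : r < k) :
    hypersimplexTerm k (i + l) (a + c) - slabTerm r k i l a c =
      (if i + l < k ∧ k < i + l + a + c ∧ r < i + a ∧ r + l < k then X ^ (a + c - 1) else 0)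
      + (if a + c = 0 ∧ i + l = k ∧ r < i then 1 else 0)
      - (if i < r ∧ r < i + a then X ^ (a - 1) else 0) *
        (if l < k - r ∧ k - r < l + c then X ^ (c - 1) else 0) * (1 + X) := by
  by_cases hB : (i < r ∧ r < i + a) ∧ (l < k - r ∧ k - r < l + c)
  · obtain ⟨h1, h2⟩ := hB
    have h3 : r + l < k ∧ k < r + l + c := by omega
    rw [hypersimplexTerm, slabTerm, if_pos h1, if_pos h2, if_pos (by omega), if_pos (by omega),
      if_pos (by omega), if_pos (by omega), if_neg (by omega)]
    obtain ⟨a, rfl⟩ : ∃ a', a = a' + 1 := ⟨a - 1, by omega⟩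
    obtain ⟨c, rfl⟩ : ∃ c', c = c' + 1 := ⟨c - 1, by omega⟩
    rw [show a + 1 + (c + 1) - 1 = a + c + 1 by omega]
    simp only [Nat.add_sub_cancel]
    ring
  · have hprod : (if i < r ∧ r < i + a then (X : ℤ[X]) ^ (a - 1) else 0) *
        (if l < k - r ∧ k - r < l + c then X ^ (c - 1) else 0) = 0 := by
      rw [not_and_or] at hB
      rcases hB with h | h
      · rw [if_neg h, zero_mul]
      · rw [if_neg h, mul_zero]
    rw [hprod, zero_mul, sub_zero, hypersimplexTerm, slabTerm]
    by_cases hΔ : (a + c = 0 ∧ i + l = k) ∨ (i + l < k ∧ k < i + l + (a + c))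
    · rw [if_pos hΔ]
      -- If such a face reaches beyond the hyperplane without being cut by it, its relative interior
      -- misses the slab.
      by_cases hmax : r < i + a ∧ r + l < k
      · rw [if_neg (by omega), if_neg (by omega)]
        rcases hΔ with ⟨h1, h2⟩ | h
        · rw [if_neg (by omega), if_pos (by omega), h1]
          simp
        · rw [if_pos (by omega), if_neg (by omega)]
          simp
      · rw [if_neg (by omega : ¬(i + l < k ∧ k < i + l + a + c ∧ r < i + a ∧ r + l < k)),
          if_neg (by omega : ¬(a + c = 0 ∧ i + l = k ∧ r < i))]
        by_cases hon : ((a = 0 ∧ i = r) ∨ (i < r ∧ r < i + a)) ∧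
            ((c = 0 ∧ r + l = k) ∨ (r + l < k ∧ k < r + l + c))
        -- The face lies in the hyperplane, so a = 0 or c = 0 and the truncated exponents agree.
        · rw [if_pos hon, if_neg (by omega), show a - 1 + (c - 1) = a + c - 1 by omega]
          simp
        · rw [if_neg hon, if_pos (by omega)]
          simp
    · rw [if_neg hΔ, if_neg (by omega), if_neg (by omega), if_neg (by omega), if_neg (by omega)]
      simp

/-! ### Matching the sums in the formula -/

theorem triCoeff_eq {N i j : ℕ} (h : i + j ≤ N) :
    triCoeff N i j = N.choose i * (N - i).choose j := by
  rw [triCoeff]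
  refine Nat.div_eq_of_eq_mul_left (by positivity) ?_
  rw [← Nat.choose_mul_factorial_mul_factorial (by omega : i ≤ N),
    ← Nat.choose_mul_factorial_mul_factorial (by omega : j ≤ N - i)]
  ring

/-- Truncation makes the condition true for every j ≥ N, but the binomial kills j > N. -/
theorem sum_choose_smul_ite_sub_eq_zero {M : Type*} [AddCommMonoid M] {N B : ℕ} (h : N < B)
    (y : M) : (∑ j ∈ Finset.range B, N.choose j • if N - j = 0 then y else 0) = y := by
  rw [Finset.sum_eq_single N]
  · simp
  · intro j _ hj
    rcases Nat.lt_or_gt_of_ne hj with h1 | h1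
    · rw [if_neg (by omega), smul_zero]
    · rw [Nat.choose_eq_zero_of_lt h1, zero_smul]
  · intro hN
    exact absurd (Finset.mem_range.2 h) hN

/-- Subtracting the binomial removes the vertices, the types without free coordinates. -/
theorem pPrime_eq {r h B : ℕ} (hB : h < B) :
    pPrime r h = ∑ i ∈ Finset.range B, ∑ j ∈ Finset.range B,
      (h.choose i * (h - i).choose j) •
        (if i < r ∧ r < i + (h - i - j) then (X : ℤ[X]) ^ (h - i - j - 1) else 0) := by
  have hf : fPoly (hypersimplex r h) = ∑ i ∈ Finset.range B, ∑ j ∈ Finset.range B,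
      (h.choose i * (h - i).choose j) • hypersimplexTerm r i (h - i - j) := by
    have hset : (Finset.univ.filter fun p : Finset (Fin h) × Finset (Fin h) =>
        Disjoint p.1 p.2) = disjointPairs Finset.univ := by
      ext p; simp [mem_disjointPairs]
    have hsum := sum_disjointPairs (fun i j => hypersimplexTerm r i (h - i - j))
      (Finset.univ : Finset (Fin h)) (N := B) (by simpa using hB)
    rw [Finset.card_univ, Fintype.card_fin] at hsum
    rw [fPoly_hypersimplex, ← hsum, hset]
    refine Finset.sum_congr rfl fun p hp => ?_
    have := card_compl_union_inter (mem_disjointPairs.1 hp).2.2 Finset.univ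
    simp only [Finset.inter_univ, Finset.card_univ, Fintype.card_fin] at this
    rw [this]
  have hterm : ∀ i j : ℕ, hypersimplexTerm r i (h - i - j) =
      (if i < r ∧ r < i + (h - i - j) then (X : ℤ[X]) ^ (h - i - j - 1) else 0) +
      (if h - i - j = 0 then (if i = r then 1 else 0) else 0) := by
    intro i j
    rw [hypersimplexTerm]
    rcases Nat.eq_zero_or_pos (h - i - j) with hw | hw
    · rw [hw, if_neg (by omega : ¬(i < r ∧ r < i + 0)), if_pos rfl, zero_add]
      exact if_congr (by omega) (by simp) rfl
    · rw [if_neg hw.ne', add_zero]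
      exact if_congr (by omega) rfl rfl
  have hvert : ∑ i ∈ Finset.range B, ∑ j ∈ Finset.range B, (h.choose i * (h - i).choose j) •
      (if h - i - j = 0 then (if i = r then (1 : ℤ[X]) else 0) else 0) = C (h.choose r : ℤ) := by
    simp only [mul_smul, ← Finset.smul_sum]
    rw [Finset.sum_congr rfl fun i _ => by
      rw [sum_choose_smul_ite_sub_eq_zero (by omega : h - i < B)]]
    simp only [smul_ite, smul_zero, Finset.sum_ite_eq', Finset.mem_range]
    split_ifs with hr
    · simp
    · rw [Nat.choose_eq_zero_of_lt (by omega)]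
      simp
  rw [pPrime, hf, ← hvert, sub_eq_iff_eq_add]
  simp only [hterm, smul_add, Finset.sum_add_distrib]

theorem sum_range_eq_sum_ite {M : Type*} [AddCommMonoid M] {b B : ℕ} (h : b ≤ B) (f : ℕ → M) :
    ∑ i ∈ Finset.range b, f i = ∑ i ∈ Finset.range B, if i < b then f i else 0 := by
  rw [← Finset.sum_filter]
  refine Finset.sum_congr ?_ fun _ _ => rfl
  ext i
  simp only [Finset.mem_range, Finset.mem_filter]
  omega

theorem ite_sum_zero {M : Type*} [AddCommMonoid M] (c : Prop) [Decidable c] (s : Finset ℕ)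
    (f : ℕ → M) : (if c then ∑ i ∈ s, f i else 0) = ∑ i ∈ s, if c then f i else 0 := by
  split_ifs <;> simp

/-- With a = h - i - j and c = n - h - l - m, the bound on j says r < i + a, those on l say i + l <
k and r + l < k, and n - k - j for m says k < i + l + a + c. The bounds i + j ≤ h and l + m ≤ n - h
are enforced by vanishing binomials. -/
theorem pPoly_eq {r k h n : ℕ} (hrk : r < k) (hkn : k < n) (hhn : h < n) :
    pPoly r k h n = ∑ i ∈ Finset.range (n + 1), ∑ j ∈ Finset.range (n + 1),
      ∑ l ∈ Finset.range (n + 1), ∑ m ∈ Finset.range (n + 1),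
        ((h.choose i * (h - i).choose j) * ((n - h).choose l * (n - h - l).choose m)) •
          (if i + l < k ∧ k < i + l + (h - i - j) + (n - h - l - m) ∧ r < i + (h - i - j) ∧
              r + l < k then (X : ℤ[X]) ^ (h - i - j + (n - h - l - m) - 1) else 0) := by
  rw [pPoly, sum_range_eq_sum_ite (by omega : h - r ≤ n + 1),
    Finset.sum_comm' (t' := Finset.range (n + 1))
      (s' := fun _ => Finset.range (n + 1)) (by simp)]
  refine Finset.sum_congr rfl fun j _ => ?_
  rw [sum_range_eq_sum_ite (by omega : min (h + 1 - j) k ≤ n + 1), ite_sum_zero]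
  refine Finset.sum_congr rfl fun i _ => ?_
  rw [sum_range_eq_sum_ite (by omega : min (k - i) (k - r) ≤ n + 1), ite_sum_zero, ite_sum_zero]
  refine Finset.sum_congr rfl fun l _ => ?_
  rw [sum_range_eq_sum_ite (by omega : min (n - h + 1 - l) (n - k - j) ≤ n + 1), ite_sum_zero,
    ite_sum_zero, ite_sum_zero]
  refine Finset.sum_congr rfl fun m _ => ?_
  simp only [← ite_and]
  by_cases h1 : i + j ≤ h
  swap
  · rw [if_neg (by omega)]
    rcases Nat.lt_or_ge h i with h2 | h2
    · rw [Nat.choose_eq_zero_of_lt h2]; simp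
    · rw [Nat.choose_eq_zero_of_lt (by omega : h - i < j)]; simp
  by_cases h2 : l + m ≤ n - h
  swap
  · rw [if_neg (by omega)]
    rcases Nat.lt_or_ge (n - h) l with h3 | h3
    · rw [Nat.choose_eq_zero_of_lt h3]; simp
    · rw [Nat.choose_eq_zero_of_lt (by omega : n - h - l < m)]; simp
  rw [triCoeff_eq h1, triCoeff_eq h2, smul_ite, smul_zero, nsmul_eq_mul,
    show h - i - j + (n - h - l - m) - 1 = n - 1 - i - j - l - m by omega]
  exact if_congr (by omega) (by simp) rfl

/-- Without free coordinates, only j = h - i, m = n - h - l and l = k - i contribute. -/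
theorem sum_vertices_eq {r k h n : ℕ} (hkn : k < n) (hhn : h < n) :
    (∑ i ∈ Finset.range (n + 1), ∑ j ∈ Finset.range (n + 1),
      ∑ l ∈ Finset.range (n + 1), ∑ m ∈ Finset.range (n + 1),
        ((h.choose i * (h - i).choose j) * ((n - h).choose l * (n - h - l).choose m)) •
          (if h - i - j + (n - h - l - m) = 0 ∧ i + l = k ∧ r < i then (1 : ℤ[X]) else 0)) =
      C (∑ i ∈ Finset.Icc (r + 1) k, ((h.choose i * (n - h).choose (k - i) : ℕ) : ℤ)) := by
  have hinner : ∀ i j, (∑ l ∈ Finset.range (n + 1), ∑ m ∈ Finset.range (n + 1),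
      ((h.choose i * (h - i).choose j) * ((n - h).choose l * (n - h - l).choose m)) •
        (if h - i - j + (n - h - l - m) = 0 ∧ i + l = k ∧ r < i then (1 : ℤ[X]) else 0)) =
      h.choose i • (h - i).choose j • if h - i - j = 0 then
        ∑ l ∈ Finset.range (n + 1), (n - h).choose l • (if i + l = k ∧ r < i then 1 else 0)
        else 0 := by
    intro i j
    rw [ite_sum_zero]
    simp only [Finset.smul_sum]
    refine Finset.sum_congr rfl fun l _ => ?_
    simp only [mul_smul, ← Finset.smul_sum]
    congr 2
    simp only [Nat.add_eq_zero_iff, ite_and]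
    split_ifs
    · rw [sum_choose_smul_ite_sub_eq_zero (by omega)]
    all_goals simp
  simp only [hinner]
  simp only [← Finset.smul_sum]
  rw [Finset.sum_congr rfl fun i _ => by
    rw [sum_choose_smul_ite_sub_eq_zero (by omega : h - i < n + 1)]]
  rw [map_sum, ← Finset.sum_subset (s₁ := Finset.Icc (r + 1) k)]
  · refine Finset.sum_congr rfl fun i hi => ?_
    rw [Finset.mem_Icc] at hi
    rw [Finset.sum_eq_single (k - i)]
    · rw [if_pos (by omega)]; simp
    · intro l _ hl
      rw [if_neg (by omega), smul_zero]
    · intro hl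
      exact absurd (Finset.mem_range.2 (by omega)) hl
  · intro i hi
    rw [Finset.mem_Icc] at hi
    exact Finset.mem_range.2 (by omega)
  · intro i _ hi
    rw [Finset.mem_Icc] at hi
    rw [Finset.sum_eq_zero, smul_zero]
    intro l _
    rw [if_neg (by omega), smul_zero]

theorem uPoly_eq {r k h n : ℕ} (hhn : h < n) :
    uPoly r k h n = ∑ i ∈ Finset.range (n + 1), ∑ j ∈ Finset.range (n + 1),
      ∑ l ∈ Finset.range (n + 1), ∑ m ∈ Finset.range (n + 1),
        ((h.choose i * (h - i).choose j) * ((n - h).choose l * (n - h - l).choose m)) •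
          (hypersimplexTerm k (i + l) (h - i - j + (n - h - l - m)) -
            slabTerm r k i l (h - i - j) (n - h - l - m)) := by
  set S : Finset (Fin n) := Finset.univ.filter fun i => i.val < h with hS
  have hcard : S.card = h := by
    rw [Fin.card_filter_val_lt, min_eq_right hhn.le]
  have hcard' : Sᶜ.card = n - h := by rw [Finset.card_compl, hcard, Fintype.card_fin]
  have hsum := sum_disjoint_card S fun i j l m =>
    hypersimplexTerm k (i + l) (h - i - j + (n - h - l - m)) -
      slabTerm r k i l (h - i - j) (n - h - l - m)
  rw [hcard, hcard'] at hsum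
  rw [← hsum, uPoly, schubertPolytope_eq_slab, fPoly_slab, fPoly_hypersimplex,
    ← Finset.sum_sub_distrib]
  refine Finset.sum_congr rfl fun p hp => ?_
  have hdisj := (Finset.mem_filter.1 hp).2
  have h1 := card_compl_union_inter hdisj S
  have h2 := card_compl_union_inter hdisj Sᶜ
  simp only [← Finset.sdiff_eq_inter_compl, hcard, hcard'] at h1 h2
  rw [← hS, h1, h2, ← Finset.card_inter_add_card_sdiff p.1 S,
    ← Finset.card_inter_add_card_sdiff (p.1 ∪ p.2)ᶜ S, h1, h2]

theorem proposition2p6 (r k h n : ℕ) (hr : 0 < r) (hrk : r < k) (hkn : k < n)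
    (hrh : r < h) (hhn : h < n) :
    uPoly r k h n =
      pPoly r k h n - pPrime r h * pPrime (k - r) (n - h) * (1 + X)
        + C (∑ i ∈ Finset.Icc (r + 1) k, ((h.choose i * (n - h).choose (k - i) : ℕ) : ℤ)) := by
  rw [uPoly_eq hhn, pPoly_eq hrk hkn hhn, ← sum_vertices_eq hkn hhn,
    pPrime_eq (by omega : h < n + 1), pPrime_eq (by omega : n - h < n + 1), sub_add_eq_add_sub]
  simp only [Finset.sum_mul]
  simp only [Finset.sum_mul, Finset.mul_sum, ← Finset.sum_add_distrib, ← Finset.sum_sub_distrib]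
  -- All sums now run over the same box with the same weights, so one type suffices.
  refine Finset.sum_congr rfl fun i _ => Finset.sum_congr rfl fun j _ =>
    Finset.sum_congr rfl fun l _ => Finset.sum_congr rfl fun m _ => ?_
  rw [hypersimplexTerm_sub_slabTerm hrk]
  simp only [nsmul_eq_mul, Nat.cast_mul]
  ring
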